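/- Let $t\ge 1$ be a fixed integer. For a binary array $X\in\{0,1\}^{a\times b}$ and integers $r,c\ge 0$, let $\mathbb D_{r,c}(X)$ be the set of arrays obtained from $X$ by deleting exactly $r$ rows and $c$ columns, and let $\mathbb I_{r,c}(X)$ be the set of arrays obtained from $X$ by inserting exactly $r$ rows and $c$ columns, i.e. the arrays $Y$ with $X\in\mathbb D_{r,c}(Y)$. A binary $t$-criss-cross insertion/deletion code is a set $\mathcal C\subseteq\{0,1\}^{n\times n}$ that corrects every $t$-criss-cross deletion (for all $r,c\ge 0$ with $r+c=t$ and all distinct $X,Y\in\mathcal C$, $\mathbb D_{r,c}(X)\cap\mathbb D_{r,c}(Y)=\emptyset$) or corrects every $t$-criss-cross insertion (the same with $\mathbb I_{r,c}$ in place of $\mathbb D_{r,c}$). Then for every $\varepsilon>0$ there is $N=N(t,\varepsilon)$ such that for all $n\ge N$ and every binary $t$-criss-cross insertion/deletion code $\mathcal C\subseteq\{0,1\}^{n\times n}$, $$|\mathcal C|\;\le\;(1+\varepsilon)\,\frac{t!\,2^{n^2}}{(2^n-1)^t\,n^t}.$$ Consequently, for every $\varepsilon>0$ there is $N'=N'(t,\varepsilon)$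 such that for all $n\ge N'$ the redundancy of every such code satisfies $$n^2-\log_2|\mathcal C|\;\ge\; t\,n+t\log_2 n-\log_2(t!)-\varepsilon .$$ -/

import Mathlib

open Filter
open scoped Nat

/-- Binary arrays with `a` rows and `b` columns. -/
abbrev BinArray (a b : ℕ) : Type := Matrix (Fin a) (Fin b) Bool

/-- The `a' × b'` arrays that result from the `a × b` array `X` by deleting exactly `r` rows and
`c` columns; the remaining rows and columns keep their order. (Empty unless `a' + r = a` and
`b' + c = b`.) -/
def deletionBall {a b : ℕ} (r c : ℕ) (X : BinArray a b) (a' b' : ℕ) : Set (BinArray a' b') :=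
  {Y | a' + r = a ∧ b' + c = b ∧
    ∃ (f : Fin a' ↪o Fin a) (g : Fin b' ↪o Fin b), Y = X.submatrix f g}

/-- The `a' × b'` arrays that result from the `a × b` array `X` by inserting exactly `r` rows and
`c` columns, that is, the arrays from which `X` is obtained by deleting `r` rows and
`c` columns. -/
def insertionBall {a b : ℕ} (r c : ℕ) (X : BinArray a b) (a' b' : ℕ) : Set (BinArray a' b') :=
  {Y | X ∈ deletionBall r c Y a b}

/-- `C` corrects every `t`-criss-cross deletion: for all `r + c = t`, distinct codewords have
disjoint `(r, c)`-criss-cross deletion balls. (For different pairs `(r, c)` the resulting arrays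
have different dimensions.) -/
def CorrectsDeletions {n : ℕ} (t : ℕ) (C : Finset (BinArray n n)) : Prop :=
  ∀ r c : ℕ, r + c = t → ∀ X ∈ C, ∀ Y ∈ C, X ≠ Y →
    ∀ a' b' : ℕ, Disjoint (deletionBall r c X a' b') (deletionBall r c Y a' b')

/-- `C` corrects every `t`-criss-cross insertion. -/
def CorrectsInsertions {n : ℕ} (t : ℕ) (C : Finset (BinArray n n)) : Prop :=
  ∀ r c : ℕ, r + c = t → ∀ X ∈ C, ∀ Y ∈ C, X ≠ Y →
    ∀ a' b' : ℕ, Disjoint (insertionBall r c X a' b') (insertionBall r c Y a' b')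

/-- A binary `t`-criss-cross insertion/deletion code. Only one of the two properties is
required, so this contains every code that has both. -/
def IsCrissCrossIndelCode {n : ℕ} (t : ℕ) (C : Finset (BinArray n n)) : Prop :=
  CorrectsDeletions t C ∨ CorrectsInsertions t C

/-- The redundancy `n² - log₂ |C|` of a code of `n × n` binary arrays. -/
noncomputable def redundancy {n : ℕ} (C : Finset (BinArray n n)) : ℝ :=
  (n : ℝ) ^ 2 - Real.logb 2 (C.card : ℝ)

/-! ### Common subsequences and common supersequences -/

section Subsequences

open scoped List

variable {α : Type*}

/-! Row deletions alone give the bound. Read an array as a word of length `n` over the `q = 2 ^ n`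
possible rows. A common subsequence of two codewords yields a common supersequence by merging, so
either kind of code has disjoint sets of length-`(n - t)` subsequences
(`IsCrissCrossIndelCode.comp_ne_comp`). A word with at least `n - t` distinct letters has at least
`n - 2 * t` letters occurring once, and deleting different `t`-sets of these gives different
results. Packing into `q ^ (n - t)` words bounds such codewords by `q ^ (n - t) / (n - 2 * t).choose
t`. All other words number at most `n ^ (2 * (t + 1)) * q ^ (n - t - 1)`, which is negligible
because `q` is exponential in `n`. -/

theorem List.ofFn_sublist_ofFn_iff {a b : ℕ} {x : Fin a → α} {y : Fin b → α} :
    List.ofFn x <+ List.ofFn y ↔ ∃ f : Fin a ↪o Fin b, x = y ∘ f := by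
  rw [List.sublist_iff_exists_fin_orderEmbedding_get_eq]
  have ha : (List.ofFn x).length = a := List.length_ofFn
  have hb : (List.ofFn y).length = b := List.length_ofFn
  constructor
  · rintro ⟨f, hf⟩
    refine ⟨((Fin.castOrderIso ha.symm).toOrderEmbedding.trans f).trans
      (Fin.castOrderIso hb).toOrderEmbedding, funext fun i => ?_⟩
    have := hf (Fin.cast ha.symm i)
    simpa [Fin.cast] using this
  · rintro ⟨f, hf⟩
    refine ⟨((Fin.castOrderIso ha).toOrderEmbedding.trans f).trans
      (Fin.castOrderIso hb.symm).toOrderEmbedding, fun i => ?_⟩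
    simp [hf, Fin.cast]

/-- Two lists with a common sublist can be merged along it. -/
theorem List.Sublist.exists_common_superlist {z : List α} :
    ∀ {x y : List α}, z <+ x → z <+ y →
      ∃ w : List α, x <+ w ∧ y <+ w ∧ w.length + z.length = x.length + y.length := by
  induction z with
  | nil =>
    intro x y _ _
    exact ⟨x ++ y, List.sublist_append_left _ _, List.sublist_append_right _ _, by simp⟩
  | cons c z ih =>
    intro x y hx hy
    obtain ⟨x₁, x₂, rfl, hx₁, hx₂⟩ := List.cons_sublist_iff.1 hx
    obtain ⟨y₁, y₂, rfl, hy₁, hy₂⟩ := List.cons_sublist_iff.1 hy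
    obtain ⟨w, hxw, hyw, hw⟩ := ih hx₂ hy₂
    obtain ⟨p, p', rfl⟩ := List.append_of_mem hx₁
    obtain ⟨s, s', rfl⟩ := List.append_of_mem hy₁
    refine ⟨(p ++ s) ++ c :: ((p' ++ s') ++ w), ?_, ?_, ?_⟩
    · simp only [List.append_assoc, List.cons_append]
      exact (List.Sublist.refl p).append (List.sublist_append_of_sublist_right
        (((List.Sublist.refl p').append
          (List.sublist_append_of_sublist_right hxw)).cons_cons c))
    · simp only [List.append_assoc, List.cons_append]
      exact List.sublist_append_of_sublist_right ((List.Sublist.refl s).append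
        ((List.sublist_append_of_sublist_right
          ((List.Sublist.refl s').append hyw)).cons_cons c))
    · simp only [List.length_append, List.length_cons] at hw ⊢
      omega

theorem exists_common_supersequence {m n t : ℕ} (hm : m + t = n) {x y : Fin n → α}
    {f g : Fin m ↪o Fin n} (h : x ∘ f = y ∘ g) :
    ∃ (w : Fin (n + t) → α) (f' g' : Fin n ↪o Fin (n + t)), x = w ∘ f' ∧ y = w ∘ g' := by
  obtain ⟨w, hx, hy, hw⟩ := List.Sublist.exists_common_superlist
    (List.ofFn_sublist_ofFn_iff.2 ⟨f, rfl⟩) (h ▸ List.ofFn_sublist_ofFn_iff.2 ⟨g, rfl⟩)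
  simp only [List.length_ofFn] at hw
  have hlen : w.length = n + t := by omega
  have hw' : w = List.ofFn fun i : Fin (n + t) => w.get (Fin.cast hlen.symm i) := by
    apply List.ext_get <;> simp [hlen]
  rw [hw'] at hx hy
  obtain ⟨f', hf'⟩ := List.ofFn_sublist_ofFn_iff.1 hx
  obtain ⟨g', hg'⟩ := List.ofFn_sublist_ofFn_iff.1 hy
  exact ⟨_, f', g', hf', hg'⟩

end Subsequences

/-! ### Reduction to words over the alphabet of rows -/

section RowDeletions

theorem comp_mem_deletionBall {a a' b r : ℕ} (ha : a' + r = a) (X : BinArray a b)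
    (f : Fin a' ↪o Fin a) : (X ∘ f : Fin a' → Fin b → Bool) ∈ deletionBall r 0 X a' b :=
  ⟨ha, rfl, f, RelEmbedding.refl _, rfl⟩

theorem IsCrissCrossIndelCode.comp_ne_comp {m n t : ℕ} {C : Finset (BinArray n n)}
    (hC : IsCrissCrossIndelCode t C) (hm : m + t = n) :
    ∀ X ∈ C, ∀ Y ∈ C, X ≠ Y → ∀ f g : Fin m ↪o Fin n, X ∘ f ≠ Y ∘ g := by
  intro X hX Y hY hXY f g h
  rcases hC with hC | hC
  · refine Set.disjoint_left.1 (hC t 0 rfl X hX Y hY hXY m n) (comp_mem_deletionBall hm X f) ?_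
    rw [h]
    exact comp_mem_deletionBall hm Y g
  · obtain ⟨w, f', g', hf', hg'⟩ := exists_common_supersequence hm h
    refine Set.disjoint_left.1 (hC t 0 rfl X hX Y hY hXY (n + t) n)
      (show w ∈ insertionBall t 0 X (n + t) n from ?_) ?_
    · change X ∈ deletionBall t 0 (w : BinArray (n + t) n) n n
      rw [hf']
      exact comp_mem_deletionBall rfl w f'
    · change Y ∈ deletionBall t 0 (w : BinArray (n + t) n) n n
      rw [hg']
      exact comp_mem_deletionBall rfl w g'

end RowDeletions

/-! ### Sphere packing over a large alphabet -/

section Counting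

variable {α : Type*} [DecidableEq α]

open Finset

/-- The subsequences of length `m` of a word. -/
noncomputable def subsequences {n : ℕ} (m : ℕ) (x : Fin n → α) : Finset (Fin m → α) :=
  univ.image fun f : Fin m ↪o Fin n => x ∘ f

/-- The positions of the letters that occur exactly once in a word. -/
def uniquePositions {n : ℕ} (x : Fin n → α) : Finset (Fin n) :=
  {i | ∀ j, x j = x i → j = i}

/-- Every letter that occurs accounts for at least two positions, except those occurring once. -/
theorem le_card_uniquePositions {n : ℕ} (x : Fin n → α) :
    2 * #(univ.image x) ≤ n + #(uniquePositions x) := by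
  have hsum : n = ∑ c ∈ univ.image x, #{i | x i = c} := by
    simpa using card_eq_sum_card_image x univ
  have hU : #((uniquePositions x).image x) = #(uniquePositions x) := by
    refine card_image_of_injOn fun i _ j hj hij => ?_
    simp only [uniquePositions, coe_filter, mem_univ, true_and, Set.mem_ofPred_eq] at hj
    exact hj i hij
  have hsub : (uniquePositions x).image x ⊆ univ.image x := image_subset_image (subset_univ _)
  calc 2 * #(univ.image x) = ∑ c ∈ univ.image x, 2 := by simp [mul_comm]
    _ ≤ ∑ c ∈ univ.image x,
          (#{i | x i = c} + if c ∈ (uniquePositions x).image x then 1 else 0) := by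
        refine sum_le_sum fun c hc => ?_
        obtain ⟨i, -, rfl⟩ := mem_image.1 hc
        have hpos : 0 < #{j | x j = x i} := card_pos.2 ⟨i, by simp⟩
        split_ifs with h
        · omega
        · have hi : i ∉ uniquePositions x := fun hi => h (mem_image_of_mem _ hi)
          simp only [uniquePositions, mem_filter, mem_univ, true_and, not_forall] at hi
          obtain ⟨j, hj, hji⟩ := hi
          have : 1 < #{j | x j = x i} :=
            one_lt_card.2 ⟨j, by simpa using hj, i, by simp, hji⟩
          omega
    _ = n + #(uniquePositions x) := by
        rw [sum_add_distrib, ← hsum, sum_boole, filter_mem_eq_inter,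
          inter_eq_right.2 hsub, hU, Nat.cast_id]

/-- A deleted `t`-set of unique positions can be read off from the result: it consists of the unique
positions whose letter has disappeared. -/
theorem choose_card_uniquePositions_le {m n t : ℕ} (hm : m + t = n) (x : Fin n → α) :
    (#(uniquePositions x)).choose t ≤ #(subsequences m x) := by
  rw [← card_powersetCard]
  refine card_le_card_of_surjOn
    (fun y => {i ∈ uniquePositions x | ∀ k, y k ≠ x i}) fun S hS => ?_
  obtain ⟨hSU, hSt⟩ := mem_powersetCard.1 hS
  have hc : #Sᶜ = m := by rw [card_compl, Fintype.card_fin, hSt]; omega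
  refine ⟨x ∘ Sᶜ.orderEmbOfFin hc, by simp [subsequences], ?_⟩
  ext i
  simp only [mem_filter, Function.comp_apply]
  constructor
  · rintro ⟨-, hi⟩
    by_contra hiS
    have : i ∈ Set.range (Sᶜ.orderEmbOfFin hc) := by simpa using hiS
    obtain ⟨k, rfl⟩ := this
    exact hi k rfl
  · refine fun hi => ⟨hSU hi, fun k hk => ?_⟩
    have hiU := hSU hi
    simp only [uniquePositions, mem_filter, mem_univ, true_and] at hiU
    have := Sᶜ.orderEmbOfFin_mem hc k
    rw [hiU _ hk] at this
    exact mem_compl.1 this hi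

variable [Fintype α]

/-- Words with few distinct letters are rare. -/
theorem card_filter_card_image_le {n s : ℕ} :
    #{x : Fin n → α | #(univ.image x) + s ≤ n} ≤
      n ^ (2 * s) * Fintype.card α ^ (n - s) := by
  classical
  -- `p.1` lists `s` redundant positions and `p.2` positions outside that list with the same
  -- letters, so `x` is determined by its other `n - s` entries.
  let B : (Fin s ↪ Fin n) × (Fin s → Fin n) → Finset (Fin n → α) := fun p =>
    {x | (∀ k, x (p.1 k) = x (p.2 k)) ∧ ∀ k l, p.2 k ≠ p.1 l}
  have hsub : ({x : Fin n → α | #(univ.image x) + s ≤ n} : Finset (Fin n → α)) ⊆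
      univ.biUnion B := by
    intro x hx
    simp only [mem_filter, mem_univ, true_and] at hx
    have hex : ∀ c : α, ∃ i : Fin n → Fin n, ∀ j, x j = c → x (i j) = c ∧ ∀ l, i l = i j := by
      intro c
      by_cases hc : ∃ i, x i = c
      · obtain ⟨i, hi⟩ := hc
        exact ⟨fun _ => i, fun _ _ => ⟨hi, fun _ => rfl⟩⟩
      · exact ⟨id, fun j hj => (hc ⟨j, hj⟩).elim⟩
    choose r hr using hex
    -- `σ` sends each position to a chosen representative of its letter; positions outside its image
    -- are redundant.
    let σ : Fin n → Fin n := fun j => r (x j) j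
    have hσ : ∀ j, x (σ j) = x j := fun j => (hr (x j) j rfl).1
    have hσ' : ∀ i j, x i = x j → σ i = σ j := by
      intro i j hij
      change r (x i) i = r (x j) j
      rw [hij]
      exact (hr (x j) j rfl).2 i
    have hcard : #(univ.image σ) ≤ #(univ.image x) := by
      refine card_le_card_of_injOn x (fun i _ => by simp) ?_
      intro i hi j hj hij
      obtain ⟨i, -, rfl⟩ := mem_image.1 (mem_coe.1 hi)
      obtain ⟨j, -, rfl⟩ := mem_image.1 (mem_coe.1 hj)
      rw [hσ, hσ] at hij
      exact hσ' i j hij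
    have hs : s ≤ #(univ.image σ)ᶜ := by
      rw [card_compl, Fintype.card_fin]
      omega
    let e : Fin s ↪ Fin n := ((Fin.castLEOrderEmb hs).trans
      ((univ.image σ)ᶜ.orderEmbOfFin rfl)).toEmbedding
    have he : ∀ k, e k ∉ univ.image σ := fun k =>
      mem_compl.1 ((univ.image σ)ᶜ.orderEmbOfFin_mem rfl _)
    refine mem_biUnion.2 ⟨(e, σ ∘ e), mem_univ _, ?_⟩
    simp only [B, mem_filter, mem_univ, true_and, Function.comp_apply]
    exact ⟨fun k => (hσ _).symm, fun k l h => he l (h ▸ mem_image_of_mem _ (mem_univ _))⟩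
  have hB : ∀ p ∈ (univ : Finset ((Fin s ↪ Fin n) × (Fin s → Fin n))),
      #(B p) ≤ Fintype.card α ^ (n - s) := by
    rintro ⟨e, p⟩ -
    have hT : #(univ.map e)ᶜ = n - s := by simp [card_compl]
    calc #(B (e, p)) ≤ #(univ : Finset (((univ.map e)ᶜ : Finset (Fin n)) → α)) := by
          refine card_le_card_of_injOn (fun x i => x i) (fun _ _ => by simp) ?_
          intro x hx y hy hxy
          simp only [B, coe_filter, mem_univ, true_and, Set.mem_ofPred_eq] at hx hy
          have hout : ∀ i, (∀ k, e k ≠ i) → x i = y i := fun i hi =>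
            congrFun hxy ⟨i, by simpa using hi⟩
          funext i
          by_cases hi : ∃ k, e k = i
          · obtain ⟨k, rfl⟩ := hi
            rw [hx.1, hy.1]
            exact hout _ fun l hl => hx.2 k l hl.symm
          · exact hout i (not_exists.1 hi)
      _ = Fintype.card α ^ (n - s) := by
          rw [card_univ, Fintype.card_fun, Fintype.card_coe, hT]
  calc #{x : Fin n → α | #(univ.image x) + s ≤ n} ≤ #(univ.biUnion B) := card_le_card hsub
    _ ≤ #(univ : Finset ((Fin s ↪ Fin n) × (Fin s → Fin n))) * Fintype.card α ^ (n - s) :=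
        card_biUnion_le_card_mul _ _ _ hB
    _ ≤ n ^ (2 * s) * Fintype.card α ^ (n - s) := by
        refine Nat.mul_le_mul_right _ ?_
        rw [card_univ, Fintype.card_prod, Fintype.card_embedding_eq, two_mul, pow_add]
        refine Nat.mul_le_mul ?_ (by simp)
        simpa using Nat.descFactorial_le_pow n s

/-- Sphere packing for words with many distinct letters. -/
theorem card_mul_choose_le {m n t : ℕ} (hm : m + t = n) {C : Finset (Fin n → α)}
    (hC : ∀ x ∈ C, ∀ y ∈ C, x ≠ y → ∀ f g : Fin m ↪o Fin n, x ∘ f ≠ y ∘ g)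
    (hgood : ∀ x ∈ C, n ≤ #(univ.image x) + t) :
    #C * (n - 2 * t).choose t ≤ Fintype.card α ^ m := by
  have hdisj : (C : Set (Fin n → α)).PairwiseDisjoint (subsequences m) := by
    intro x hx y hy hxy
    refine disjoint_left.2 fun z hzx hzy => ?_
    obtain ⟨f, -, rfl⟩ := mem_image.1 hzx
    obtain ⟨g, -, hg⟩ := mem_image.1 hzy
    exact hC x hx y hy hxy f g hg.symm
  calc #C * (n - 2 * t).choose t ≤ ∑ x ∈ C, #(subsequences m x) := by
        rw [← smul_eq_mul]
        refine card_nsmul_le_sum _ _ _ fun x hx => ?_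
        refine (Nat.choose_le_choose t ?_).trans (choose_card_uniquePositions_le hm x)
        have := le_card_uniquePositions x
        have := hgood x hx
        omega
    _ = #(C.biUnion (subsequences m)) := (card_biUnion hdisj).symm
    _ ≤ #(univ : Finset (Fin m → α)) := card_le_card (subset_univ _)
    _ = Fintype.card α ^ m := by simp

theorem card_mul_choose_le_add {m n t : ℕ} (hm : m + t = n) {C : Finset (Fin n → α)}
    (hC : ∀ x ∈ C, ∀ y ∈ C, x ≠ y → ∀ f g : Fin m ↪o Fin n, x ∘ f ≠ y ∘ g) :
    #C * (n - 2 * t).choose t ≤ Fintype.card α ^ m +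
      n ^ (2 * (t + 1)) * Fintype.card α ^ (m - 1) * (n - 2 * t).choose t := by
  have h₁ : #{x ∈ C | ¬ #(univ.image x) + (t + 1) ≤ n} * (n - 2 * t).choose t ≤
      Fintype.card α ^ m := by
    refine card_mul_choose_le hm (fun x hx y hy => hC x (mem_filter.1 hx).1 y
      (mem_filter.1 hy).1) fun x hx => ?_
    have := (mem_filter.1 hx).2
    omega
  have h₂ : #{x ∈ C | #(univ.image x) + (t + 1) ≤ n} ≤
      n ^ (2 * (t + 1)) * Fintype.card α ^ (m - 1) := by
    refine (card_le_card (filter_subset_filter _ (subset_univ C))).trans ?_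
    have := card_filter_card_image_le (α := α) (n := n) (s := t + 1)
    rwa [show n - (t + 1) = m - 1 by omega] at this
  rw [← card_filter_add_card_filter_not (s := C)
    (fun x : Fin n → α => #(univ.image x) + (t + 1) ≤ n), add_mul, add_comm]
  exact Nat.add_le_add h₁ (Nat.mul_le_mul_right _ h₂)

end Counting

/-! ### Asymptotics of the packing bound -/

section Asymptotics

open Topology

/-- The summands are the contributions of the typical and the exceptional words, each divided by `t!
* q ^ (n - t) / n ^ t` with `q = 2 ^ n`. -/
theorem tendsto_pow_div_descFactorial_add (t : ℕ) :
    Tendsto (fun n : ℕ => (n : ℝ) ^ t / ((t ! : ℕ) * ((n - 2 * t).choose t : ℕ)) +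
      (n : ℝ) ^ (3 * t + 2) / ((t ! : ℕ) * 2 ^ n)) atTop (𝓝 1) := by
  have h₁ : Tendsto (fun n : ℕ => (n : ℝ) ^ t / ((t ! : ℕ) * ((n - 2 * t).choose t : ℕ)))
      atTop (𝓝 1) := by
    have hupper : Tendsto (fun n : ℕ => ((n : ℝ) / (n + (-(3 * t) : ℝ))) ^ t) atTop (𝓝 1) := by
      simpa using (tendsto_natCast_div_add_atTop (-(3 * t) : ℝ)).pow t
    refine tendsto_of_tendsto_of_tendsto_of_le_of_le' tendsto_const_nhds hupper ?_ ?_ <;>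
    · filter_upwards [eventually_gt_atTop (3 * t)] with n hn
      have hdesc : ((t ! : ℕ) : ℝ) * ((n - 2 * t).choose t : ℕ) =
          ((n - 2 * t).descFactorial t : ℕ) := by
        rw [Nat.descFactorial_eq_factorial_mul_choose, Nat.cast_mul]
      have hlow : ((n : ℝ) + -(3 * t)) ^ t ≤ ((n - 2 * t).descFactorial t : ℕ) := by
        have h := Nat.pow_sub_le_descFactorial (n - 2 * t) t
        have h' : (n - 3 * t) ^ t ≤ (n - 2 * t).descFactorial t :=
          (Nat.pow_le_pow_left (by omega) t).trans h
        have hcast : (n : ℝ) + -(3 * t) = ((n - 3 * t : ℕ) : ℝ) := by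
          rw [Nat.cast_sub hn.le]; push_cast; ring
        rw [hcast]
        exact_mod_cast h'
      have hbase : 0 < (n : ℝ) + -(3 * t) := by
        have : ((3 * t : ℕ) : ℝ) < n := by exact_mod_cast hn
        push_cast at this
        linarith
      have hpos := (pow_pos hbase t).trans_le hlow
      rw [hdesc]
      first
      | rw [one_le_div hpos]
        exact_mod_cast (Nat.descFactorial_le_pow _ t).trans
          (Nat.pow_le_pow_left (Nat.sub_le _ _) t)
      | rw [div_pow]
        gcongr
  have h₂ : Tendsto (fun n : ℕ => (n : ℝ) ^ (3 * t + 2) / ((t ! : ℕ) * 2 ^ n))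
      atTop (𝓝 0) := by
    have := (tendsto_pow_const_div_const_pow_of_one_lt (3 * t + 2) one_lt_two).div_const
      ((t ! : ℕ) : ℝ)
    rw [zero_div] at this
    refine this.congr fun n => ?_
    rw [div_div, mul_comm ((2 : ℝ) ^ n)]
  simpa using h₁.add h₂

theorem eventually_card_le (t : ℕ) {ε : ℝ} (hε : 0 < ε) :
    ∀ᶠ n : ℕ in atTop, ∀ C : Finset (BinArray n n), IsCrissCrossIndelCode t C →
      (C.card : ℝ) ≤
        (1 + ε) * (((t ! : ℕ) : ℝ) * (2 : ℝ) ^ (n ^ 2) / (((2 : ℝ) ^ n) ^ t * (n : ℝ) ^ t)) := by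
  filter_upwards [(tendsto_pow_div_descFactorial_add t).eventually_le_const
    (lt_add_of_pos_right 1 hε), eventually_gt_atTop (3 * t)] with n hn hnt C hC
  -- Writing `n - t` as `m + 1` removes the truncated subtraction in the exponent.
  obtain ⟨m, hndef⟩ : ∃ m, n = m + 1 + t := ⟨n - 1 - t, by omega⟩
  have hcount := card_mul_choose_le_add (α := Fin n → Bool) (m := m + 1) hndef.symm (C := C)
    (hC.comp_ne_comp hndef.symm)
  have hchoose : 0 < (n - 2 * t).choose t := Nat.choose_pos (by omega)
  have hq : Fintype.card (Fin n → Bool) = 2 ^ n := by simp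
  rw [hq, Nat.add_sub_cancel] at hcount
  generalize (n - 2 * t).choose t = b at hn hcount hchoose
  have hcountR : (C.card : ℝ) * b ≤ ((2 : ℝ) ^ n) ^ (m + 1) +
      (n : ℝ) ^ (2 * (t + 1)) * ((2 : ℝ) ^ n) ^ m * b := by
    exact_mod_cast hcount
  have hsq : (2 : ℝ) ^ (n ^ 2) = ((2 : ℝ) ^ n) ^ (m + 1) * ((2 : ℝ) ^ n) ^ t := by
    rw [← pow_add, ← hndef, ← pow_mul, sq]
  have hb : (0 : ℝ) < b := by exact_mod_cast hchoose
  have hn0 : (0 : ℝ) < n := by exact_mod_cast (show 0 < n by omega)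
  have hf : (0 : ℝ) < (t ! : ℕ) := by exact_mod_cast Nat.factorial_pos t
  have hq0 : (0 : ℝ) < 2 ^ n := by positivity
  rw [hsq]
  generalize (2 : ℝ) ^ n = q at *
  calc (C.card : ℝ) ≤ (q ^ (m + 1) + (n : ℝ) ^ (2 * (t + 1)) * q ^ m * b) / b := by
        rwa [le_div_iff₀ hb]
    _ = ((n : ℝ) ^ t / ((t ! : ℕ) * b) + (n : ℝ) ^ (3 * t + 2) / ((t ! : ℕ) * q)) *
          ((t ! : ℕ) * (q ^ (m + 1) * q ^ t) / (q ^ t * (n : ℝ) ^ t)) := by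
        field_simp
        ring
    _ ≤ _ := by gcongr

end Asymptotics

theorem mainTheorem2 (t : ℕ) (ht : 0 < t) :
    (∀ ε : ℝ, 0 < ε → ∀ᶠ n : ℕ in atTop, ∀ C : Finset (BinArray n n),
      IsCrissCrossIndelCode t C →
        (C.card : ℝ) ≤ (1 + ε) *
          (((t ! : ℕ) : ℝ) * (2 : ℝ) ^ (n ^ 2) / (((2 : ℝ) ^ n - 1) ^ t * (n : ℝ) ^ t))) ∧
    (∀ ε : ℝ, 0 < ε → ∀ᶠ n : ℕ in atTop, ∀ C : Finset (BinArray n n),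
      IsCrissCrossIndelCode t C →
        (t : ℝ) * n + t * Real.logb 2 n - Real.logb 2 ((t ! : ℕ) : ℝ) - ε ≤ redundancy C) := by
  constructor
  · intro ε hε
    filter_upwards [eventually_card_le t hε, eventually_gt_atTop 0] with n hn hn0 C hC
    refine (hn C hC).trans ?_
    have hq : (0 : ℝ) < 2 ^ n - 1 := sub_pos.2 (one_lt_pow₀ one_lt_two hn0.ne')
    have hn0' : (0 : ℝ) < n := by exact_mod_cast hn0
    gcongr
    exact sub_le_self _ zero_le_one
  · intro ε hε
    -- With this choice the factor `1 + (2 ^ ε - 1)` has binary logarithm exactly `ε`.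
    have hε' : (0 : ℝ) < 2 ^ ε - 1 := sub_pos.2 (Real.one_lt_rpow one_lt_two hε)
    filter_upwards [eventually_card_le t hε', eventually_gt_atTop 0] with n hn hn0 C hC
    have hnonempty : ∀ D : Finset (BinArray n n), IsCrissCrossIndelCode t D → D.Nonempty →
        (t : ℝ) * n + t * Real.logb 2 n - Real.logb 2 ((t ! : ℕ) : ℝ) - ε ≤ redundancy D := by
      intro D hD hDne
      have hn0' : (n : ℝ) ≠ 0 := by exact_mod_cast hn0.ne'
      have hf : ((t ! : ℕ) : ℝ) ≠ 0 := by exact_mod_cast Nat.factorial_ne_zero t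
      have hlog := Real.logb_le_logb_of_le one_lt_two
        (by exact_mod_cast hDne.card_pos : (0 : ℝ) < D.card) (hn D hD)
      rw [add_sub_cancel, Real.logb_mul (by positivity) (by positivity),
        Real.logb_rpow two_pos (by norm_num), Real.logb_div (by positivity) (by positivity),
        Real.logb_mul hf (by positivity), Real.logb_mul (by positivity) (by positivity),
        Real.logb_pow, Real.logb_pow, Real.logb_pow, Real.logb_pow,
        Real.logb_self_eq_one one_lt_two] at hlog
      push_cast at hlog
      unfold redundancy
      linarith
    rcases C.eq_empty_or_nonempty with rfl | hne
    -- Since `Real.logb 2 0 = 0`, the empty code has the redundancy of a singleton.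
    · have hsingle := hnonempty {0} (Or.inl fun r c _ X hX Y hY hXY => (hXY (by
        rw [Finset.mem_singleton.1 hX, Finset.mem_singleton.1 hY])).elim)
        (Finset.singleton_nonempty _)
      simpa [redundancy] using hsingle
    · exact hnonempty C hC hne
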